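/- **Setting.** Let $S\subset\mathbb R^n$ be closed and convex with $\operatorname{int}S\neq\emptyset$. A function $d:\mathbb R^n\times\mathbb R^n\to[0,\infty]$ is a *proximal distance* with respect to $S$ if, for every $y\in\operatorname{int}S$, $d(\cdot,y)$ is proper, lower semicontinuous, convex and $C^1$ on $\operatorname{int}S$, $\operatorname{dom}d(\cdot,y)\subset S$ and $\operatorname{dom}\partial_1d(\cdot,y)=\operatorname{int}S$. A function $D:\mathbb R^n\times\mathbb R^n\to[0,\infty]$ with $\operatorname{int}S\times\operatorname{int}S\subset\operatorname{dom}D$ is an *induced proximal distance* to $d$ if: * (H1) for $x\in\operatorname{int}S$, $D(x,\cdot)$ is continuous on $\operatorname{int}S$; * (H2) $D(x,x)=0$ for $x\in\operatorname{int}S$; * (H3) for $x\in S$, $\alpha\in\mathbb R$, the set $\{y\in\operatorname{int}S: D(x,y)\le\alpha\}$ is bounded; * (H4) there is $\gamma>0$ with $\langle z-x,\nabla_1d(x,y)\rangle+D(z,x)+\gamma D(x,y)\le D(z,y)$ for all $x,y\in\operatorname{int}S$, $z\in S$; * (H5) if $y^k\in\operatorname{int}S$ and $y^k\to y\in S$,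 then $D(y,y^k)\to0$; * (H6) for $z\in S$, $y\in\operatorname{int}S$, $\alpha\in(0,1)$ and $w=\alpha z+(1-\alpha)y$: $D(z,w)+D(w,y)\le D(z,y)$; * (H7) if $x^k,y^k\in\operatorname{int}S$, $x^k\to x$, $y^k\to y$ and $x\ne y$, then $\liminf_kD(x^k,y^k)>0$. Fix such a pair $(d,D)$. Let $K\subset\mathbb R^n$ be closed and convex with $K\subset\operatorname{int}(\operatorname{dom}d(\cdot,y))$ for all $y\in\operatorname{int}S$, and suppose that for each $c\in K$ the map $\nabla_1d(\cdot,c)$ is strictly monotone on $K$. For $\psi:C\times C\to\mathbb R$ put $S(\psi,C)=\{u\in C:\psi(u,y)\ge0\ \forall y\in C\}$. Let $f,h:K\times K\to\mathbb R$ both satisfy, for all $x,y\in K$: (L1) $\psi(x,x)=0$; (L2) $\psi(\cdot,y)$ is upper semicontinuous on $K$; (L3) $\psi(x,\cdot)$ is convex and lower semicontinuous on $K$; (L4) $\psi(x,y)+\psi(y,x)\le0$. Let $\varepsilon_k>0$ with $\varepsilon_k\to\infty$, and $\lambda_k\ge\theta>0$ (so $\sum_k\lambda_k=\infty$), $k=0,1,2,\dots$.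 Assume (L6): for every $k$, every $c\in K$ and every sequence $(y^m)$ in $K$ with $\|y^m\|\to\infty$, $$\liminf_{m\to\infty}\Big[\varepsilon_kf(c,y^m)+h(c,y^m)+\lambda_k^{-1}\langle\nabla_1d(y^m,c),y^m-c\rangle\Big]>0 .$$ **Algorithm.** Start from $x^0\in K$; given $x^k$, choose $x^{k+1}\in S(f_k,K)$, where $$f_k(x,y)=\varepsilon_kf(x,y)+h(x,y)+\tfrac1{\lambda_k}\langle\nabla_1d(x,x^k),y-x\rangle .$$ Stop if $x^{k+1}=x^k\in S(f,K)$. **Condition $(\mathcal H)$ at $(z,p)$.** For $z\in S(h,S(f,K))$ and $p\in\mathcal N_{S(f,K)}(z)$ (normal cone) with $-p\in\partial h_z(z)$, where $f_z=f(z,\cdot)$ and $h_z=h(z,\cdot)$ are functions on $K$: $$\sum_{k=1}^\infty\lambda_k\varepsilon_k\Big[f_z^*\big(\tfrac{2p}{\varepsilon_k}\big)-\sigma_{S(f,K)}\big(\tfrac{2p}{\varepsilon_k}\big)\Big]<\infty ,$$ with $f_z^*(q)=\sup_{y\in K}(\langle q,y\rangle-f(z,y))$ and $\sigma_{S(f,K)}(q)=\sup_{y\in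 S(f,K)}\langle q,y\rangle$. **Theorem.** Suppose $S(f,K)\ne\emptyset$. Then for every $x^0\in K$: 1. The sequence of the algorithm is well defined: there is exactly one sequence of iterates starting at $x^0$, both when the stopping rule is ignored (an infinite sequence) and when it is in force (the sequence being continued by its last term after a stop). 2. Let $(x^k)$ be either of these sequences and let $z\in S(h,S(f,K))$. If $(\mathcal H)$ holds at $(z,p)$ for some $p\in\mathcal N_{S(f,K)}(z)$ with $-p\in\partial h_z(z)$, then * (a) $\lim_{k}D(z,x^k)$ exists and is finite; * (b) $(x^k)$ is bounded; * (c) $D(x^{k+1},x^k)\to0$ and $x^{k+1}-x^k\to0$; * (d) the terms $\lambda_k\varepsilon_kf(z,x^{k+1})$ are nonnegative and $\sum_{k}\lambda_k\varepsilon_kf(z,x^{k+1})<\infty$. -/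

import Mathlib

open Set Filter Topology
open scoped ENNReal NNReal

noncomputable section

/-- `ℝⁿ` with its Euclidean inner product and norm. -/
abbrev Rn (n : ℕ) : Type := EuclideanSpace ℝ (Fin n)

/-! ### Equilibrium problems

A bifunction `ψ : K × K → ℝ` is represented by a function on all of `ℝⁿ × ℝⁿ`; every notion
below uses only its values on `K × K`. -/

/-- The solution set `S(ψ, K) = {u ∈ K : ψ(u, y) ≥ 0 for all y ∈ K}`. -/
def equilibriumSet {n : ℕ} (ψ : Rn n → Rn n → ℝ) (K : Set (Rn n)) : Set (Rn n) :=
  {u | u ∈ K ∧ ∀ y ∈ K, 0 ≤ ψ u y}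

/-- Conditions (L1)-(L4) for a bifunction on `K`. -/
structure IsMonotoneBifunction {n : ℕ} (K : Set (Rn n)) (ψ : Rn n → Rn n → ℝ) : Prop where
  diag_zero : ∀ x ∈ K, ψ x x = 0
  upperSemicontinuousOn : ∀ y ∈ K, UpperSemicontinuousOn (fun x => ψ x y) K
  convexOn : ∀ x ∈ K, ConvexOn ℝ K (ψ x)
  lowerSemicontinuousOn : ∀ x ∈ K, LowerSemicontinuousOn (ψ x) K
  monotone : ∀ x ∈ K, ∀ y ∈ K, ψ x y + ψ y x ≤ 0

/-! ### Convex analysis -/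

/-- The subdifferential at `x` of an extended-valued function `φ : ℝⁿ → [0, ∞]`. -/
def extSubdifferential {n : ℕ} (φ : Rn n → ℝ≥0∞) (x : Rn n) : Set (Rn n) :=
  {v | φ x ≠ ⊤ ∧ ∀ u, ((φ x : ℝ≥0∞) : EReal) + ((inner ℝ v (u - x) : ℝ) : EReal) ≤
    ((φ u : ℝ≥0∞) : EReal)}

/-- The subdifferential at `x ∈ K` of a real function `φ` on `K` (equivalently, of `φ` extended
by `+∞` outside `K`). -/
def subdifferentialOn {n : ℕ} (K : Set (Rn n)) (φ : Rn n → ℝ) (x : Rn n) : Set (Rn n) :=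
  {v | x ∈ K ∧ ∀ y ∈ K, φ x + inner ℝ v (y - x) ≤ φ y}

/-- The normal cone of `C` at `x`, empty if `x ∉ C`. -/
def normalCone {n : ℕ} (C : Set (Rn n)) (x : Rn n) : Set (Rn n) :=
  {q | x ∈ C ∧ ∀ y ∈ C, inner ℝ q (y - x) ≤ (0 : ℝ)}

/-- The support function `σ_C(q) = sup_{y ∈ C} ⟨q, y⟩`. -/
def supportFn {n : ℕ} (C : Set (Rn n)) (q : Rn n) : EReal :=
  ⨆ y ∈ C, ((inner ℝ q y : ℝ) : EReal)

/-- The conjugate `φ^*(q) = sup_{y ∈ K} (⟨q, y⟩ - φ(y))` of a real function `φ` on `K`. -/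
def conjugateOn {n : ℕ} (K : Set (Rn n)) (φ : Rn n → ℝ) (q : Rn n) : EReal :=
  ⨆ y ∈ K, ((inner ℝ q y - φ y : ℝ) : EReal)

/-! ### Generalized proximal distances -/

/-- `∇₁ d(x, y)`, the gradient at `x` of `d(·, y)` (for `x` where `d(·, y)` is finite and
differentiable). -/
def grad₁ {n : ℕ} (d : Rn n → Rn n → ℝ≥0∞) (x y : Rn n) : Rn n :=
  gradient (fun u => (d u y).toReal) x

/-- `d : ℝⁿ × ℝⁿ → [0, ∞]` is a proximal distance with respect to `S`. -/
structure IsProximalDistance {n : ℕ} (S : Set (Rn n)) (d : Rn n → Rn n → ℝ≥0∞) : Prop where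
  proper : ∀ y ∈ interior S, ∃ x, d x y ≠ ⊤
  lowerSemicontinuous : ∀ y ∈ interior S, LowerSemicontinuous (fun x => d x y)
  convexOn : ∀ y ∈ interior S, ConvexOn ℝ≥0 univ (fun x => d x y)
  contDiffOn : ∀ y ∈ interior S, ContDiffOn ℝ 1 (fun x => (d x y).toReal) (interior S)
  dom_subset : ∀ y ∈ interior S, {x | d x y ≠ ⊤} ⊆ S
  dom_subdifferential : ∀ y ∈ interior S,
    {x | (extSubdifferential (fun u => d u y) x).Nonempty} = interior S

/-- `D : ℝⁿ × ℝⁿ → [0, ∞]` is an induced proximal distance to the proximal distance `d`: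
`int S × int S ⊆ dom D` and (H1)-(H7). -/
structure IsInducedProximalDistance {n : ℕ} (S : Set (Rn n)) (d D : Rn n → Rn n → ℝ≥0∞) :
    Prop where
  finite : ∀ x ∈ interior S, ∀ y ∈ interior S, D x y ≠ ⊤
  h1 : ∀ x ∈ interior S, ContinuousOn (D x) (interior S)
  h2 : ∀ x ∈ interior S, D x x = 0
  h3 : ∀ x ∈ S, ∀ α : ℝ,
    Bornology.IsBounded {y | y ∈ interior S ∧ ((D x y : ℝ≥0∞) : EReal) ≤ (α : EReal)}
  /-- `⟨z - x, ∇₁ d(x, y)⟩ ≤ D(z, y) - D(z, x) - γ D(x, y)`, written without differences of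
  possibly infinite quantities. -/
  h4 : ∃ γ : ℝ≥0, 0 < γ ∧ ∀ x ∈ interior S, ∀ y ∈ interior S, ∀ z ∈ S,
    ((inner ℝ (z - x) (grad₁ d x y) : ℝ) : EReal)
      + ((D z x + (γ : ℝ≥0∞) * D x y : ℝ≥0∞) : EReal) ≤ ((D z y : ℝ≥0∞) : EReal)
  h5 : ∀ (v : ℕ → Rn n) (y : Rn n), (∀ k, v k ∈ interior S) → y ∈ S →
    Tendsto v atTop (𝓝 y) → Tendsto (fun k => D y (v k)) atTop (𝓝 0)
  h6 : ∀ z ∈ S, ∀ y ∈ interior S, ∀ α ∈ Ioo (0 : ℝ) 1,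
    D z (α • z + (1 - α) • y) + D (α • z + (1 - α) • y) y ≤ D z y
  h7 : ∀ (u v : ℕ → Rn n) (x y : Rn n), (∀ k, u k ∈ interior S) → (∀ k, v k ∈ interior S) →
    Tendsto u atTop (𝓝 x) → Tendsto v atTop (𝓝 y) → x ≠ y →
    0 < liminf (fun k => D (u k) (v k)) atTop

/-! ### The proximal point algorithm -/

/-- The regularized bifunction
`(x, y) ↦ ε f(x, y) + h(x, y) + λ⁻¹ ⟨∇₁ d(x, c), y - x⟩` with proximal centre `c`. -/
def regularized {n : ℕ} (f h : Rn n → Rn n → ℝ) (d : Rn n → Rn n → ℝ≥0∞) (ε lam : ℝ)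
    (c x y : Rn n) : ℝ :=
  ε * f x y + h x y + 1 / lam * inner ℝ (grad₁ d x c) (y - x)

/-- The coercivity condition (L6) at `c ∈ K` with parameters `ε` and `λ`. -/
def CoercivityL6 {n : ℕ} (K : Set (Rn n)) (f h : Rn n → Rn n → ℝ) (d : Rn n → Rn n → ℝ≥0∞)
    (ε lam : ℝ) (c : Rn n) : Prop :=
  ∀ v : ℕ → Rn n, (∀ m, v m ∈ K) → Tendsto (fun m => ‖v m‖) atTop atTop →
    0 < liminf (fun m =>
      ((ε * f c (v m) + h c (v m) + lam⁻¹ * inner ℝ (grad₁ d (v m) c) (v m - c) : ℝ) : EReal))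
      atTop

/-- `x` is an infinite sequence of iterates: `x⁰ ∈ K` and `x^{k+1} ∈ S(f_k, K)` for all `k`, with
`f_k` the regularized bifunction centred at `x^k` (iterating past the stopping test). -/
def IsIteration {n : ℕ} (K : Set (Rn n)) (f h : Rn n → Rn n → ℝ) (d : Rn n → Rn n → ℝ≥0∞)
    (ε lam : ℕ → ℝ) (x : ℕ → Rn n) : Prop :=
  x 0 ∈ K ∧ ∀ k, x (k + 1) ∈ equilibriumSet (regularized f h d (ε k) (lam k) (x k)) K

/-- The stopping test has succeeded before the step that computes `x^{k+1}`:
`x^{j+1} = x^j ∈ S(f, K)` for some `j < k`. -/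
def HasStopped {n : ℕ} (K : Set (Rn n)) (f : Rn n → Rn n → ℝ) (x : ℕ → Rn n) (k : ℕ) : Prop :=
  ∃ j < k, x (j + 1) = x j ∧ x j ∈ equilibriumSet f K

/-- `x` is the sequence of iterates with the stopping rule in force; after the stop it is continued
by its last term. -/
def IsStoppedIteration {n : ℕ} (K : Set (Rn n)) (f h : Rn n → Rn n → ℝ)
    (d : Rn n → Rn n → ℝ≥0∞) (ε lam : ℕ → ℝ) (x : ℕ → Rn n) : Prop :=
  x 0 ∈ K ∧ ∀ k,
    (¬ HasStopped K f x k →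
      x (k + 1) ∈ equilibriumSet (regularized f h d (ε k) (lam k) (x k)) K) ∧
    (HasStopped K f x k → x (k + 1) = x k)

/-- Condition (H) at `z ∈ S(f, K)` and `p ∈ N_{S(f, K)}(z)`:
`∑_{k ≥ 1} λ_k ε_k [f_z^*(q^k) - σ_{S(f,K)}(q^k)] < ∞` with `q^k = 2p / ε_k`. For such `z`, `p`
the value `σ_{S(f,K)}(q^k) = ⟨q^k, z⟩` is finite and the bracket lies in `[0, ∞]`. -/
def ConditionH {n : ℕ} (K : Set (Rn n)) (f : Rn n → Rn n → ℝ) (ε lam : ℕ → ℝ)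
    (z p : Rn n) : Prop :=
  ∑' k : ℕ, ENNReal.ofReal (lam (k + 1) * ε (k + 1)) *
    (conjugateOn K (f z) ((2 / ε (k + 1)) • p)
      - supportFn (equilibriumSet f K) ((2 / ε (k + 1)) • p)).toENNReal < ⊤

end

/-!
The proof has two independent halves.

*Existence of the iterates.* For a monotone bifunction `ψ` no fixed point theorem is needed. By
Minty's lemma (`IsMonotoneBifunction.mem_equilibriumSet_of_forall_le`) it suffices to solve the dual
problem `ψ(y, x) ≤ 0` for all `y`, whose constraint sets are closed. On a compact set it is
therefore enough to satisfy finitely many of these inequalities, and on the convex hull of the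
finitely many `y`'s convexity reduces this to the matrix `A i j = ψ(y i, y j)`, which satisfies
`A + Aᵀ ≤ 0`; a separation argument gives a point `t` of the simplex with `A t ≤ 0`
(`exists_mem_stdSimplex_mulVec_nonpos`). Coercivity (L6) confines the solutions to a ball, which
removes compactness, and strict monotonicity of `∇₁ d(·, c)` gives uniqueness.

*Asymptotics.* Testing the proximal step against `z` and using monotonicity, `-p ∈ ∂h_z(z)` and (H4),
`D(z, x⁺) + γ D(x⁺, x) + λ ε f(z, x⁺) ≤ D(z, x) + λ ⟨p, x⁺ - z⟩`.
With `q = 2p / ε` one has `λ ⟨p, x⁺ - z⟩ = (λ ε / 2) ⟨q, x⁺ - z⟩`, and `σ(q) = ⟨q, z⟩` together with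
the Fenchel-Young inequality bounds this by `(λ ε / 2) (f(z, x⁺) + f_z^*(q) - σ(q))`. Half of the `f`
term absorbs the first summand, and condition (H) makes the rest summable
(`ConditionH.exists_summable`). Hence `D(z, x^k)` is quasi-Fejér, so that it converges and the
decrements `γ D(x⁺, x) + (λ ε / 2) f(z, x⁺)` are summable; (H3) gives boundedness and (H7) turns
`D(x⁺, x) → 0` into `x⁺ - x → 0`. A sequence that was stopped is eventually constant at a point of
`S(f, K)`, where `f(z, ·)` vanishes (`asymptotics_of_eventually_const`).
-/

/-! ### Monotone equilibrium problems on compact sets -/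

/-- A matrix game whose payoff matrix satisfies `A + Aᵀ ≤ 0` has a nonpositive value: the player
who chooses columns has a mixed strategy `t` with `A t ≤ 0`. -/
theorem exists_mem_stdSimplex_mulVec_nonpos {ι : Type*} [Fintype ι] [Nonempty ι]
    (A : Matrix ι ι ℝ) (hA : ∀ i j, A i j + A j i ≤ 0) :
    ∃ t ∈ stdSimplex ℝ ι, ∀ j, A.mulVec t j ≤ 0 := by
  classical
  by_contra! hcon
  obtain ⟨φ, u, v, hs, huv, ht⟩ := geometric_hahn_banach_compact_closed
    (s := A.mulVecLin '' stdSimplex ℝ ι) (t := Iic (0 : ι → ℝ))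
    ((convex_stdSimplex ℝ ι).linear_image _)
    ((isCompact_stdSimplex ℝ ι).image (LinearMap.continuous_of_finiteDimensional _))
    (convex_Iic 0) isClosed_Iic (by
      rw [Set.disjoint_left]
      rintro _ ⟨t, ht, rfl⟩ hle
      obtain ⟨j, hj⟩ := hcon t ht
      exact absurd (hle j) (not_le.2 (by simpa using hj)))
  have hv : v < 0 := by simpa using ht 0 (mem_Iic.2 le_rfl)
  set s : ι → ℝ := fun j => - φ (Pi.single j 1) with hsdef
  -- `φ` is bounded below on the nonpositive orthant, hence nonpositive on the positive axes.
  have hs0 : ∀ j, 0 ≤ s j := by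
    intro j
    by_contra! hneg
    have h1 := ht ((v / s j) • -(Pi.single j (1 : ℝ))) (by
      intro i
      have : 0 ≤ v / s j := (div_pos_of_neg_of_neg hv hneg).le
      have h2 : (0 : ℝ) ≤ (Pi.single j (1 : ℝ) : ι → ℝ) i := by
        by_cases hij : i = j
        · subst hij; simp
        · simp [hij]
      simpa using mul_nonneg this h2)
    have h3 : φ ((v / s j) • -(Pi.single j (1 : ℝ))) = v := by
      rw [map_smul, map_neg, smul_eq_mul]
      exact div_mul_cancel₀ v hneg.ne
    exact absurd h1 (by rw [h3]; exact lt_irrefl v)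
  have hφ : ∀ w : ι → ℝ, φ w = - ∑ j, s j * w j := by
    intro w
    conv_lhs => rw [pi_eq_sum_univ' w]
    simp [hsdef, mul_comm]
  have hsum : 0 < ∑ j, s j := by
    refine lt_of_le_of_ne (Finset.sum_nonneg fun j _ => hs0 j) fun h0 => ?_
    have hz : ∀ j, s j = 0 := fun j =>
      (Finset.sum_eq_zero_iff_of_nonneg fun j _ => hs0 j).1 h0.symm j (Finset.mem_univ j)
    let i : ι := Classical.arbitrary ι
    have := hs _ ⟨Pi.single i 1, single_mem_stdSimplex ℝ i, rfl⟩
    rw [hφ] at this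
    simp only [hz, zero_mul, Finset.sum_const_zero, neg_zero] at this
    linarith
  have hmem : (∑ j, s j)⁻¹ • s ∈ stdSimplex ℝ ι := by
    refine ⟨fun j => mul_nonneg (inv_nonneg.2 hsum.le) (hs0 j), ?_⟩
    simp only [Pi.smul_apply, smul_eq_mul, ← Finset.mul_sum]
    exact inv_mul_cancel₀ hsum.ne'
  have hlt := (hs _ ⟨_, hmem, rfl⟩).trans huv
  rw [map_smul, map_smul, hφ, smul_eq_mul] at hlt
  -- The quadratic form of `A` is that of its symmetric part, so it is nonpositive at `s ≥ 0`.
  have hq : ∑ j, s j * A.mulVecLin s j ≤ 0 := by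
    have e : ∑ j, s j * A.mulVecLin s j = ∑ j, ∑ i, s j * s i * A j i := by
      simp only [Matrix.mulVecLin_apply, Matrix.mulVec, dotProduct, Finset.mul_sum]
      exact Finset.sum_congr rfl fun j _ => Finset.sum_congr rfl fun i _ => by ring
    have e' : ∑ j, ∑ i, s j * s i * A j i = ∑ j, ∑ i, s j * s i * A i j := by
      rw [Finset.sum_comm]
      exact Finset.sum_congr rfl fun j _ => Finset.sum_congr rfl fun i _ => by ring
    have : ∑ j, ∑ i, s j * s i * A j i + ∑ j, ∑ i, s j * s i * A i j ≤ 0 := by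
      simp only [← Finset.sum_add_distrib, ← mul_add]
      exact Finset.sum_nonpos fun j _ => Finset.sum_nonpos fun i _ =>
        mul_nonpos_of_nonneg_of_nonpos (mul_nonneg (hs0 j) (hs0 i)) (hA j i)
    rw [e]; linarith
  have := mul_nonneg (inv_nonneg.2 hsum.le) (neg_nonneg.2 hq)
  linarith

section

variable {n : ℕ} {S K : Set (Rn n)} {ψ f h : Rn n → Rn n → ℝ} {d D : Rn n → Rn n → ℝ≥0∞}

theorem IsMonotoneBifunction.mono (hψ : IsMonotoneBifunction K ψ) {C : Set (Rn n)} (hCK : C ⊆ K)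
    (hC : Convex ℝ C) : IsMonotoneBifunction C ψ where
  diag_zero x hx := hψ.diag_zero x (hCK hx)
  upperSemicontinuousOn y hy := (hψ.upperSemicontinuousOn y (hCK hy)).mono hCK
  convexOn x hx := (hψ.convexOn x (hCK hx)).subset hCK hC
  lowerSemicontinuousOn x hx := (hψ.lowerSemicontinuousOn x (hCK hx)).mono hCK
  monotone x hx y hy := hψ.monotone x (hCK hx) y (hCK hy)

/-- Minty's lemma: a solution of the dual problem `ψ(y, x) ≤ 0` for all `y ∈ K` solves the
equilibrium problem. -/
theorem IsMonotoneBifunction.mem_equilibriumSet_of_forall_le (hψ : IsMonotoneBifunction K ψ)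
    (hK : Convex ℝ K) {x : Rn n} (hx : x ∈ K) (h : ∀ y ∈ K, ψ y x ≤ 0) :
    x ∈ equilibriumSet ψ K := by
  refine ⟨hx, fun y hy => ?_⟩
  by_contra! hneg
  have hmem : ∀ t ∈ Ioo (0 : ℝ) 1, AffineMap.lineMap x y t ∈ K := fun t ht =>
    hK.lineMap_mem hx hy ⟨ht.1.le, ht.2.le⟩
  have hev : ∀ᶠ t in 𝓝[>] (0 : ℝ), t ∈ Ioo (0 : ℝ) 1 := Ioo_mem_nhdsGT one_pos
  have hlim : Tendsto (fun t : ℝ => (AffineMap.lineMap x y t : Rn n)) (𝓝[>] 0) (𝓝[K] x) := by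
    refine tendsto_nhdsWithin_iff.2 ⟨?_, hev.mono hmem⟩
    have : Continuous fun t : ℝ => (AffineMap.lineMap x y t : Rn n) :=
      AffineMap.lineMap_continuous
    simpa using (this.tendsto 0).mono_left nhdsWithin_le_nhds
  obtain ⟨t, ht, hlt⟩ :=
    (hev.and (hlim.eventually (hψ.upperSemicontinuousOn y hy x hx 0 hneg))).exists
  have hw := hmem t ht
  have hc := (hψ.convexOn _ hw).2 hx hy (sub_nonneg.2 ht.2.le) ht.1.le (sub_add_cancel 1 t)
  have he : (1 - t) • x + t • y = AffineMap.lineMap x y t := by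
    rw [AffineMap.lineMap_apply_module]
  rw [he, hψ.diag_zero _ hw, smul_eq_mul, smul_eq_mul] at hc
  have h1 := mul_nonpos_of_nonneg_of_nonpos (sub_nonneg.2 ht.2.le) (h _ hw)
  have h2 := mul_neg_of_pos_of_neg ht.1 hlt
  linarith

/-- Finitely many of the inequalities `ψ(y, x) ≤ 0` of the dual problem have a common solution:
in the convex hull of the `y`'s this is a matrix game. -/
theorem IsMonotoneBifunction.exists_forall_finset_le (hψ : IsMonotoneBifunction K ψ)
    (hK : Convex ℝ K) (hne : K.Nonempty) (T : Finset K) :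
    ∃ x ∈ K, ∀ y ∈ T, ψ y x ≤ 0 := by
  classical
  rcases T.eq_empty_or_nonempty with rfl | hT
  · exact ⟨_, hne.some_mem, by simp⟩
  have : Nonempty T := hT.to_subtype
  obtain ⟨t, ⟨ht0, ht1⟩, hle⟩ := exists_mem_stdSimplex_mulVec_nonpos
    (Matrix.of fun i j : T => ψ i.1 j.1) (fun i j => hψ.monotone _ i.1.2 _ j.1.2)
  refine ⟨∑ i, t i • (i.1 : Rn n), hK.sum_mem (fun i _ => ht0 i) ht1 fun i _ => i.1.2,
    fun y hy => ?_⟩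
  refine ((hψ.convexOn _ y.2).map_sum_le (fun i _ => ht0 i) ht1 fun i _ => i.1.2).trans ?_
  refine le_of_eq_of_le ?_ (hle ⟨y, hy⟩)
  simp [Matrix.mulVec, dotProduct, mul_comm]

theorem IsMonotoneBifunction.equilibriumSet_nonempty_of_isCompact
    (hψ : IsMonotoneBifunction K ψ) (hK : Convex ℝ K) (hKc : IsCompact K) (hne : K.Nonempty) :
    (equilibriumSet ψ K).Nonempty := by
  have hfin : (K ∩ ⋂ y ∈ K, ψ y ⁻¹' Iic 0).Nonempty := by
    rw [nonempty_iff_ne_empty, Ne,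
      LowerSemicontinuousOn.inter_biInter_preimage_Iic_eq_empty_iff_exists_finset hKc
        hψ.lowerSemicontinuousOn]
    rintro ⟨T, hT⟩
    obtain ⟨x, hxK, hx⟩ := hψ.exists_forall_finset_le hK hne T
    obtain ⟨y, hy, hlt⟩ := hT x hxK
    exact absurd (hx y hy) (not_le.2 hlt)
  obtain ⟨x, hxK, hx⟩ := hfin
  exact ⟨x, hψ.mem_equilibriumSet_of_forall_le hK hxK fun y hy => mem_iInter₂.1 hx y hy⟩

/-- If `ψ(·, c)` is negative on `K` far from the origin, then the equilibrium problem on the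
possibly unbounded set `K` is solved by any solution in a large enough ball. -/
theorem IsMonotoneBifunction.equilibriumSet_nonempty_of_coercive
    (hψ : IsMonotoneBifunction K ψ) (hK : Convex ℝ K) (hKc : IsClosed K) {c : Rn n} (hc : c ∈ K)
    {R : ℝ} (hR : ∀ y ∈ K, R < ‖y‖ → ψ y c < 0) : (equilibriumSet ψ K).Nonempty := by
  set r := max R ‖c‖ + 1 with hr
  have hC : Convex ℝ (K ∩ Metric.closedBall 0 r) := hK.inter (convex_closedBall _ _)
  have hcr : ‖c‖ ≤ r := (le_max_right R ‖c‖).trans (by linarith)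
  obtain ⟨x, ⟨hxK, hxr⟩, hx⟩ := (hψ.mono inter_subset_left hC).equilibriumSet_nonempty_of_isCompact
    hC ((isCompact_closedBall _ _).inter_left hKc) ⟨c, hc, by simpa using hcr⟩
  have hxR : ‖x‖ ≤ R := by
    by_contra! hlt
    exact absurd (hx c ⟨hc, by simpa using hcr⟩) (not_le.2 (hR x hxK hlt))
  have hxlt : ‖x‖ < r := lt_of_le_of_lt (hxR.trans (le_max_left R ‖c‖)) (by linarith)
  refine ⟨x, hxK, fun y hy => ?_⟩
  -- A short step from `x` towards `y` stays in the ball, where `x` is a solution.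
  have hlim : Tendsto (fun t : ℝ => ‖(AffineMap.lineMap x y t : Rn n)‖) (𝓝[>] 0) (𝓝 ‖x‖) := by
    have : Continuous fun t : ℝ => ‖(AffineMap.lineMap x y t : Rn n)‖ :=
      AffineMap.lineMap_continuous.norm
    simpa using (this.tendsto 0).mono_left nhdsWithin_le_nhds
  have hev : ∀ᶠ t in 𝓝[>] (0 : ℝ), t ∈ Ioo (0 : ℝ) 1 := Ioo_mem_nhdsGT one_pos
  obtain ⟨t, ht, hlt⟩ := (hev.and (hlim.eventually_lt_const hxlt)).exists
  have h0 := hx (AffineMap.lineMap x y t)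
    ⟨hK.lineMap_mem hxK hy ⟨ht.1.le, ht.2.le⟩, by simpa using hlt.le⟩
  have hcv := (hψ.convexOn x hxK).2 hxK hy (sub_nonneg.2 ht.2.le) ht.1.le (sub_add_cancel 1 t)
  have he : (1 - t) • x + t • y = AffineMap.lineMap x y t := by
    rw [AffineMap.lineMap_apply_module]
  rw [he, hψ.diag_zero x hxK, smul_eq_mul, smul_eq_mul, mul_zero, zero_add] at hcv
  exact nonneg_of_mul_nonneg_right (h0.trans hcv) ht.1

/-! ### The proximal step -/

theorem IsProximalDistance.continuousOn_grad₁ (hd : IsProximalDistance S d) {c : Rn n}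
    (hc : c ∈ interior S) : ContinuousOn (fun x => grad₁ d x c) (interior S) :=
  (InnerProductSpace.toDual ℝ (Rn n)).symm.continuous.comp_continuousOn
    ((hd.contDiffOn c hc).continuousOn_fderiv_of_isOpen isOpen_interior le_rfl)

theorem IsProximalDistance.subset_interior (hd : IsProximalDistance S d)
    (hS : (interior S).Nonempty) (hK : ∀ y ∈ interior S, K ⊆ interior {x | d x y ≠ ⊤}) :
    K ⊆ interior S :=
  (hK _ hS.some_mem).trans (interior_mono (hd.dom_subset _ hS.some_mem))

theorem upperSemicontinuousOn_const_mul {φ : Rn n → ℝ} (hφ : UpperSemicontinuousOn φ K) {a : ℝ}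
    (ha : 0 ≤ a) : UpperSemicontinuousOn (fun x => a * φ x) K :=
  (continuous_const_mul a).comp_upperSemicontinuousOn hφ (monotone_mul_left_of_nonneg ha)

theorem lowerSemicontinuousOn_const_mul {φ : Rn n → ℝ} (hφ : LowerSemicontinuousOn φ K) {a : ℝ}
    (ha : 0 ≤ a) : LowerSemicontinuousOn (fun x => a * φ x) K :=
  (continuous_const_mul a).comp_lowerSemicontinuousOn hφ (monotone_mul_left_of_nonneg ha)

/-- The regularization contributes a strictly negative term to `f_k(x, y) + f_k(y, x)`. -/
theorem regularized_add_regularized_swap_lt (hf : IsMonotoneBifunction K f)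
    (hh : IsMonotoneBifunction K h) {ε lam : ℝ} (hε : 0 < ε) (hlam : 0 < lam) {c x y : Rn n}
    (hx : x ∈ K) (hy : y ∈ K)
    (hxy : (0 : ℝ) < inner ℝ (grad₁ d x c - grad₁ d y c) (x - y)) :
    regularized f h d ε lam c x y + regularized f h d ε lam c y x < 0 := by
  have h1 := mul_nonpos_of_nonneg_of_nonpos hε.le (hf.monotone x hx y hy)
  have h2 := hh.monotone x hx y hy
  have h3 := mul_pos (one_div_pos.2 hlam) hxy
  have h4 : inner ℝ (grad₁ d x c - grad₁ d y c) (x - y)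
      = - (inner ℝ (grad₁ d x c) (y - x) + inner ℝ (grad₁ d y c) (x - y) : ℝ) := by
    rw [inner_sub_left, ← neg_sub y x, inner_neg_right, inner_neg_right]
    ring
  rw [h4] at h3
  simp only [regularized]
  linarith

theorem isMonotoneBifunction_regularized (hf : IsMonotoneBifunction K f)
    (hh : IsMonotoneBifunction K h) (hK : Convex ℝ K) {ε lam : ℝ} (hε : 0 < ε) (hlam : 0 < lam)
    {c : Rn n} (hcont : ContinuousOn (fun x => grad₁ d x c) K)
    (hmono : ∀ x ∈ K, ∀ y ∈ K, x ≠ y →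
      (0 : ℝ) < inner ℝ (grad₁ d x c - grad₁ d y c) (x - y)) :
    IsMonotoneBifunction K (regularized f h d ε lam c) where
  diag_zero x hx := by simp [regularized, hf.diag_zero x hx, hh.diag_zero x hx]
  upperSemicontinuousOn y hy := by
    refine ((upperSemicontinuousOn_const_mul (hf.upperSemicontinuousOn y hy) hε.le).add
      (hh.upperSemicontinuousOn y hy)).add (ContinuousOn.upperSemicontinuousOn ?_)
    fun_prop
  convexOn x hx := by
    refine (((hf.convexOn x hx).smul hε.le).add (hh.convexOn x hx)).add ⟨hK, ?_⟩
    intro y _ z _ a b _ _ hab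
    have : a • y + b • z - x = a • (y - x) + b • (z - x) := by
      calc a • y + b • z - x = a • y + b • z - (a + b) • x := by rw [hab, one_smul]
        _ = _ := by module
    refine le_of_eq ?_
    simp only [this, inner_add_right, inner_smul_right, smul_eq_mul]
    ring
  lowerSemicontinuousOn x hx := by
    refine ((lowerSemicontinuousOn_const_mul (hf.lowerSemicontinuousOn x hx) hε.le).add
      (hh.lowerSemicontinuousOn x hx)).add (ContinuousOn.lowerSemicontinuousOn ?_)
    fun_prop
  monotone x hx y hy := by
    by_cases hxy : x = y
    · subst hxy
      simp [regularized, hf.diag_zero x hx, hh.diag_zero x hx]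
    · exact (regularized_add_regularized_swap_lt hf hh hε hlam hx hy (hmono x hx y hy hxy)).le

/-- Under the coercivity condition (L6), `f_k(·, c)` is negative on `K` far from the origin. -/
theorem CoercivityL6.exists_radius (hf : IsMonotoneBifunction K f)
    (hh : IsMonotoneBifunction K h) {ε lam : ℝ} (hε : 0 < ε) {c : Rn n} (hc : c ∈ K)
    (hL6 : CoercivityL6 K f h d ε lam c) :
    ∃ R : ℝ, ∀ y ∈ K, R < ‖y‖ → regularized f h d ε lam c y c < 0 := by
  by_contra! hcon
  choose v hvK hvn hv using fun m : ℕ => hcon m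
  have hpos := hL6 v hvK (tendsto_atTop_mono (fun m => (hvn m).le) tendsto_natCast_atTop_atTop)
  refine absurd hpos (not_lt.2 (liminf_le_of_le ?_ fun b hb => ?_))
  · isBoundedDefault
  · obtain ⟨m, hm⟩ := hb.exists
    refine hm.trans ?_
    have h1 := mul_nonpos_of_nonneg_of_nonpos hε.le (hf.monotone _ hc _ (hvK m))
    have h2 := hh.monotone _ hc _ (hvK m)
    have h3 := hv m
    simp only [regularized, one_div] at h3
    rw [← neg_sub, inner_neg_right] at h3
    exact_mod_cast (by linarith : ε * f c (v m) + h c (v m)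
      + lam⁻¹ * inner ℝ (grad₁ d (v m) c) (v m - c) ≤ 0)

/-- The proximal step is well defined: the regularized problem has exactly one solution. -/
theorem existsUnique_mem_equilibriumSet_regularized (hf : IsMonotoneBifunction K f)
    (hh : IsMonotoneBifunction K h) (hK : Convex ℝ K) (hKc : IsClosed K) {ε lam : ℝ} (hε : 0 < ε)
    (hlam : 0 < lam) {c : Rn n} (hc : c ∈ K) (hcont : ContinuousOn (fun x => grad₁ d x c) K)
    (hmono : ∀ x ∈ K, ∀ y ∈ K, x ≠ y →
      (0 : ℝ) < inner ℝ (grad₁ d x c - grad₁ d y c) (x - y))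
    (hL6 : CoercivityL6 K f h d ε lam c) :
    ∃! x, x ∈ equilibriumSet (regularized f h d ε lam c) K := by
  obtain ⟨R, hR⟩ := hL6.exists_radius hf hh hε hc
  obtain ⟨x, hx⟩ := (isMonotoneBifunction_regularized hf hh hK hε hlam hcont
    hmono).equilibriumSet_nonempty_of_coercive hK hKc hc hR
  refine ⟨x, hx, fun y hy => ?_⟩
  by_contra hxy
  have h1 := regularized_add_regularized_swap_lt hf hh hε hlam hy.1 hx.1
    (hmono y hy.1 x hx.1 hxy)
  have h2 := hx.2 y hy.1
  have h3 := hy.2 x hx.1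
  linarith

/-! ### The sequences of iterates -/

theorem IsIteration.mem {ε lam : ℕ → ℝ} {x : ℕ → Rn n} (hx : IsIteration K f h d ε lam x) :
    ∀ k, x k ∈ K
  | 0 => hx.1
  | k + 1 => (hx.2 k).1

theorem existsUnique_isIteration {ε lam : ℕ → ℝ}
    (hstep : ∀ k, ∀ c ∈ K,
      ∃! x, x ∈ equilibriumSet (regularized f h d (ε k) (lam k) c) K)
    {x₀ : Rn n} (hx₀ : x₀ ∈ K) : ∃! x : ℕ → Rn n, x 0 = x₀ ∧ IsIteration K f h d ε lam x := by
  choose g hg using fun k (c : K) => (hstep k c c.2).exists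
  obtain ⟨x, hx0, hxs⟩ : ∃ x : ℕ → K, x 0 = ⟨x₀, hx₀⟩ ∧
      ∀ k, x (k + 1) = ⟨g k (x k), (hg k (x k)).1⟩ :=
    ⟨fun k => Nat.rec ⟨x₀, hx₀⟩ (fun k c => ⟨g k c, (hg k c).1⟩) k, rfl, fun _ => rfl⟩
  have hxg : ∀ k, (x (k + 1) : Rn n) = g k (x k) := fun k => by rw [hxs]
  refine ⟨fun k => x k, ⟨by simp [hx0], (x 0).2, fun k => ?_⟩, ?_⟩
  · beta_reduce
    rw [hxg]
    exact hg k (x k)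
  rintro y ⟨hy0, hy⟩
  funext k
  induction k with
  | zero => rw [hy0, hx0]
  | succ k ih =>
    refine (hstep k (y k) (hy.mem k)).unique (hy.2 k) ?_
    rw [ih, hxg]
    exact hg k (x k)

theorem hasStopped_congr {x y : ℕ → Rn n} {k : ℕ} (hxy : ∀ j ≤ k, x j = y j) :
    HasStopped K f x k ↔ HasStopped K f y k := by
  refine exists_congr fun j => and_congr_right fun hj => ?_
  rw [hxy j hj.le, hxy (j + 1) hj]

theorem IsStoppedIteration.mem {ε lam : ℕ → ℝ} {x : ℕ → Rn n}
    (hx : IsStoppedIteration K f h d ε lam x) (k : ℕ) : x k ∈ K := by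
  induction k with
  | zero => exact hx.1
  | succ k ih =>
    by_cases hk : HasStopped K f x k
    · rw [(hx.2 k).2 hk]; exact ih
    · exact ((hx.2 k).1 hk).1

theorem IsStoppedIteration.eq {ε lam : ℕ → ℝ}
    (hstep : ∀ k, ∀ c ∈ K,
      ∃! x, x ∈ equilibriumSet (regularized f h d (ε k) (lam k) c) K)
    {x y : ℕ → Rn n} (hx : IsStoppedIteration K f h d ε lam x)
    (hy : IsStoppedIteration K f h d ε lam y) (h0 : x 0 = y 0) : x = y := by
  funext k
  induction k using Nat.strong_induction_on with
  | _ k ih =>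
    cases k with
    | zero => exact h0
    | succ k =>
      have hk := ih k k.lt_succ_self
      have hiff : HasStopped K f x k ↔ HasStopped K f y k :=
        hasStopped_congr fun j hj => ih j (Nat.lt_succ_of_le hj)
      by_cases hs : HasStopped K f x k
      · rw [(hx.2 k).2 hs, (hy.2 k).2 (hiff.1 hs), hk]
      · refine (hstep k (x k) (hx.mem k)).unique ((hx.2 k).1 hs) ?_
        rw [hk]
        exact (hy.2 k).1 (hiff.not.1 hs)

/-- An infinite sequence of iterates that never meets the stopping test is the stopped sequence. -/
theorem IsIteration.isStoppedIteration {ε lam : ℕ → ℝ} {x : ℕ → Rn n}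
    (hx : IsIteration K f h d ε lam x) (hs : ∀ k, ¬ HasStopped K f x k) :
    IsStoppedIteration K f h d ε lam x :=
  ⟨hx.1, fun k => ⟨fun _ => hx.2 k, fun h => absurd h (hs k)⟩⟩

/-- An infinite sequence of iterates, frozen at the first index that meets the stopping test, is
the stopped sequence. -/
theorem IsIteration.isStoppedIteration_min {ε lam : ℕ → ℝ} {x : ℕ → Rn n}
    (hx : IsIteration K f h d ε lam x) {j : ℕ} (hj : x (j + 1) = x j ∧ x j ∈ equilibriumSet f K)
    (hmin : ∀ i < j, ¬ (x (i + 1) = x i ∧ x i ∈ equilibriumSet f K)) :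
    IsStoppedIteration K f h d ε lam (fun k => x (min k j)) := by
  have hst : ∀ k, HasStopped K f (fun k => x (min k j)) k ↔ j < k := by
    refine fun k => ⟨?_, fun hk => ⟨j, hk, by simp, by simpa using hj.2⟩⟩
    rintro ⟨i, hik, hi⟩
    by_contra! hkj
    refine hmin i (hik.trans_le hkj) ?_
    simpa only [min_eq_left (show i ≤ j by omega), min_eq_left (show i + 1 ≤ j by omega)] using hi
  refine ⟨by simpa using hx.1, fun k => ⟨fun hk => ?_, fun hk => ?_⟩⟩
  · rw [hst, not_lt] at hk
    have hxk : x (min (k + 1) j) = x (k + 1) := by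
      rcases hk.lt_or_eq with hlt | rfl
      · rw [min_eq_left hlt]
      · rw [min_eq_right k.le_succ, hj.1]
    simpa only [min_eq_left hk, hxk] using hx.2 k
  · rw [hst] at hk
    simp only [min_eq_right hk.le, min_eq_right (hk.le.trans k.le_succ)]

/-- The stopped sequence is the infinite one, or the infinite one frozen at an index `j` at which
the iterate solves the equilibrium problem for `f`. -/
theorem IsStoppedIteration.eq_or_eq_min {ε lam : ℕ → ℝ}
    (hstep : ∀ k, ∀ c ∈ K,
      ∃! x, x ∈ equilibriumSet (regularized f h d (ε k) (lam k) c) K)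
    {x y : ℕ → Rn n} (hx : IsIteration K f h d ε lam x)
    (hy : IsStoppedIteration K f h d ε lam y) (h0 : y 0 = x 0) :
    y = x ∨ ∃ j, x j ∈ equilibriumSet f K ∧ y = fun k => x (min k j) := by
  classical
  by_cases hs : ∃ j, x (j + 1) = x j ∧ x j ∈ equilibriumSet f K
  · refine Or.inr ⟨Nat.find hs, (Nat.find_spec hs).2, ?_⟩
    refine hy.eq hstep (hx.isStoppedIteration_min (Nat.find_spec hs)
      fun i hi => Nat.find_min hs hi) ?_
    simpa using h0
  · exact Or.inl (hy.eq hstep (hx.isStoppedIteration fun k ⟨j, _, hj⟩ => hs ⟨j, hj⟩) h0)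

theorem existsUnique_isStoppedIteration {ε lam : ℕ → ℝ}
    (hstep : ∀ k, ∀ c ∈ K,
      ∃! x, x ∈ equilibriumSet (regularized f h d (ε k) (lam k) c) K)
    {x₀ : Rn n} (hx₀ : x₀ ∈ K) :
    ∃! x : ℕ → Rn n, x 0 = x₀ ∧ IsStoppedIteration K f h d ε lam x := by
  classical
  obtain ⟨x, ⟨hx0, hx⟩, -⟩ := existsUnique_isIteration hstep hx₀
  have hex : ∃ y : ℕ → Rn n, y 0 = x₀ ∧ IsStoppedIteration K f h d ε lam y := by
    by_cases hs : ∃ j, x (j + 1) = x j ∧ x j ∈ equilibriumSet f K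
    · exact ⟨_, by simpa using hx0, hx.isStoppedIteration_min (Nat.find_spec hs)
        fun i hi => Nat.find_min hs hi⟩
    · exact ⟨x, hx0, hx.isStoppedIteration fun k ⟨j, _, hj⟩ => hs ⟨j, hj⟩⟩
  obtain ⟨y, hy0, hy⟩ := hex
  exact ⟨y, ⟨hy0, hy⟩, fun y' hy' => hy'.2.eq hstep hy (hy'.1.trans hy0.symm)⟩

/-! ### Asymptotics of the iterates -/

/-- A quasi-Fejér sequence of nonnegative reals converges, and its decrements are summable. -/
theorem exists_tendsto_and_summable_of_add_le {a b e : ℕ → ℝ} (ha : ∀ k, 0 ≤ a k)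
    (hb : ∀ k, 0 ≤ b k) (he : ∀ k, 0 ≤ e k) (hes : Summable e)
    (hle : ∀ k, a (k + 1) + b k ≤ a k + e k) :
    (∃ l, Tendsto a atTop (𝓝 l)) ∧ Summable b := by
  have hE : ∀ k, ∑ i ∈ Finset.range k, e i ≤ ∑' i, e i := fun k =>
    hes.sum_le_tsum _ fun i _ => he i
  constructor
  · have hanti : Antitone fun k => a k - ∑ i ∈ Finset.range k, e i := by
      refine antitone_nat_of_succ_le fun k => ?_
      rw [Finset.sum_range_succ]
      linarith [hle k, hb k]
    have hbdd : BddBelow (range fun k => a k - ∑ i ∈ Finset.range k, e i) := by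
      refine ⟨-∑' i, e i, ?_⟩
      rintro _ ⟨k, rfl⟩
      linarith [ha k, hE k]
    have := (tendsto_atTop_ciInf hanti hbdd).add hes.hasSum.tendsto_sum_nat
    exact ⟨_, by simpa using this⟩
  · have hsum : ∀ k, a k + ∑ i ∈ Finset.range k, b i ≤ a 0 + ∑ i ∈ Finset.range k, e i := by
      intro k
      induction k with
      | zero => simp
      | succ k ih =>
        rw [Finset.sum_range_succ, Finset.sum_range_succ]
        linarith [hle k]
    exact summable_of_sum_range_le (c := a 0 + ∑' i, e i) hb fun k => by
      linarith [hsum k, hE k, ha k]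

/-- (H4) in real terms, for points at which all the distances involved are finite. -/
theorem IsInducedProximalDistance.exists_toReal_le (hD : IsInducedProximalDistance S d D) :
    ∃ γ : ℝ, 0 < γ ∧ ∀ x ∈ interior S, ∀ y ∈ interior S, ∀ z ∈ interior S,
      inner ℝ (z - x) (grad₁ d x y) + ((D z x).toReal + γ * (D x y).toReal) ≤ (D z y).toReal := by
  obtain ⟨γ, hγ, hle⟩ := hD.h4
  refine ⟨γ, hγ, fun x hx y hy z hz => ?_⟩
  have h1 := hle x hx y hy z (interior_subset hz)
  have hzx := hD.finite z hz x hx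
  have hxy := hD.finite x hx y hy
  have hzy := hD.finite z hz y hy
  lift D z x to ℝ≥0 using hzx with a
  lift D x y to ℝ≥0 using hxy with b
  lift D z y to ℝ≥0 using hzy with c
  rw [← ENNReal.coe_mul, ← ENNReal.coe_add, EReal.coe_nnreal_eq_coe_real,
    EReal.coe_nnreal_eq_coe_real, ← EReal.coe_add, EReal.coe_le_coe_iff] at h1
  simpa using h1

/-- By (H7), bounded sequences with vanishing mutual `D`-distance approach each other. -/
theorem IsInducedProximalDistance.tendsto_sub_zero (hD : IsInducedProximalDistance S d D)
    {u v : ℕ → Rn n} (hu : ∀ k, u k ∈ interior S) (hv : ∀ k, v k ∈ interior S)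
    (hub : Bornology.IsBounded (range u)) (hvb : Bornology.IsBounded (range v))
    (h0 : Tendsto (fun k => D (u k) (v k)) atTop (𝓝 0)) :
    Tendsto (fun k => u k - v k) atTop (𝓝 0) := by
  refine tendsto_of_subseq_tendsto fun ns hns => ?_
  obtain ⟨a, -, φ, hφ, ha⟩ := tendsto_subseq_of_bounded hub fun k => mem_range_self (ns k)
  obtain ⟨b, -, χ, hχ, hb⟩ := tendsto_subseq_of_bounded hvb fun k => mem_range_self (ns (φ k))
  have ha' := ha.comp hχ.tendsto_atTop
  refine ⟨φ ∘ χ, ?_⟩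
  have hab : a = b := by
    by_contra hne
    have hpos := hD.h7 (fun k => u (ns (φ (χ k)))) (fun k => v (ns (φ (χ k)))) a b
      (fun k => hu _) (fun k => hv _) ha' hb hne
    have hlim := h0.comp (hns.comp (hφ.tendsto_atTop.comp hχ.tendsto_atTop))
    exact hpos.ne' hlim.liminf_eq
  simpa [hab] using ha'.sub hb

/-- The bracket in condition (H) dominates the Fenchel-Young gap of `f(z, ·)` at each `y ∈ K`,
because `σ_C(q) = ⟨q, z⟩` for `q` in the normal cone of `C` at `z`. -/
theorem ofReal_le_toENNReal_conjugateOn_sub_supportFn {C : Set (Rn n)} {φ : Rn n → ℝ}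
    {z q y : Rn n} (hq : q ∈ normalCone C z) (hy : y ∈ K) :
    ENNReal.ofReal (inner ℝ q (y - z) - φ y) ≤
      (conjugateOn K φ q - supportFn C q).toENNReal := by
  have h1 : ((inner ℝ q y - φ y : ℝ) : EReal) ≤ conjugateOn K φ q :=
    le_iSup₂ (f := fun y (_ : y ∈ K) => ((inner ℝ q y - φ y : ℝ) : EReal)) y hy
  have h2 : supportFn C q ≤ ((inner ℝ q z : ℝ) : EReal) := iSup₂_le fun w hw => by
    have := hq.2 w hw
    rw [inner_sub_right] at this
    exact_mod_cast (by linarith : (inner ℝ q w : ℝ) ≤ inner ℝ q z)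
  have h3 := EReal.toENNReal_le_toENNReal (EReal.sub_le_sub h1 h2)
  rw [← EReal.coe_sub, EReal.real_coe_toENNReal] at h3
  rw [inner_sub_right]
  convert h3 using 2
  ring

/-- The linear term that `h` leaves in the descent estimate is absorbed, up to a summable error,
by half of the `f` term. -/
theorem ConditionH.exists_summable {ε lam : ℕ → ℝ} (hε : ∀ k, 0 < ε k) (hlam : ∀ k, 0 < lam k)
    {z p : Rn n} (hp : p ∈ normalCone (equilibriumSet f K) z) (hH : ConditionH K f ε lam z p)
    {y : ℕ → Rn n} (hy : ∀ k, y k ∈ K) :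
    ∃ e : ℕ → ℝ, (∀ k, 0 ≤ e k) ∧ Summable e ∧ ∀ k,
      lam (k + 1) * inner ℝ p (y k - z)
        ≤ lam (k + 1) * ε (k + 1) / 2 * f z (y k) + e k := by
  set B : ℕ → ℝ≥0∞ := fun k => ENNReal.ofReal (lam (k + 1) * ε (k + 1)) *
    (conjugateOn K (f z) ((2 / ε (k + 1)) • p)
      - supportFn (equilibriumSet f K) ((2 / ε (k + 1)) • p)).toENNReal with hB
  have hsum : ∑' k, B k ≠ ⊤ := hH.ne
  refine ⟨fun k => (B k).toReal / 2, fun k => by positivity,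
    (ENNReal.summable_toReal hsum).div_const 2, fun k => ?_⟩
  have hεk := hε (k + 1)
  have hq : (2 / ε (k + 1)) • p ∈ normalCone (equilibriumSet f K) z := by
    refine ⟨hp.1, fun w hw => ?_⟩
    rw [real_inner_smul_left]
    exact mul_nonpos_of_nonneg_of_nonpos (by positivity) (hp.2 w hw)
  have hle : lam (k + 1) * ε (k + 1) *
      (inner ℝ ((2 / ε (k + 1)) • p) (y k - z) - f z (y k)) ≤ (B k).toReal := by
    rw [← ENNReal.ofReal_le_iff_le_toReal (ENNReal.ne_top_of_tsum_ne_top hsum k),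
      ENNReal.ofReal_mul (mul_pos (hlam _) hεk).le]
    exact mul_le_mul_right (ofReal_le_toENNReal_conjugateOn_sub_supportFn hq (hy k)) _
  rw [real_inner_smul_left] at hle
  have heq : lam (k + 1) * ε (k + 1) *
      (2 / ε (k + 1) * inner ℝ p (y k - z) - f z (y k))
      = 2 * (lam (k + 1) * inner ℝ p (y k - z)) - lam (k + 1) * ε (k + 1) * f z (y k) := by
    field_simp
  linarith

/-- The basic estimate of one proximal step, tested against `z`. -/
theorem inner_grad₁_ge_of_mem_equilibriumSet_regularized (hf : IsMonotoneBifunction K f)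
    (hh : IsMonotoneBifunction K h) {ε lam : ℝ} (hε : 0 < ε) (hlam : 0 < lam) {c x z p : Rn n}
    (hx : x ∈ equilibriumSet (regularized f h d ε lam c) K)
    (hp : -p ∈ subdifferentialOn K (h z) z) :
    lam * ε * f z x - lam * inner ℝ p (x - z) ≤ inner ℝ (z - x) (grad₁ d x c) := by
  have h1 := hx.2 z hp.1
  have h2 := mul_nonpos_of_nonneg_of_nonpos hε.le (hf.monotone z hp.1 x hx.1)
  have h3 := hh.monotone z hp.1 x hx.1
  have h4 := hp.2 x hx.1
  rw [hh.diag_zero z hp.1, inner_neg_left] at h4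
  simp only [regularized] at h1
  rw [real_inner_comm (grad₁ d x c)]
  have h5 : 0 ≤ lam * (-(ε * f z x) + inner ℝ p (x - z)
      + 1 / lam * inner ℝ (grad₁ d x c) (z - x)) := mul_nonneg hlam.le (by linarith)
  have h6 : lam * (-(ε * f z x) + inner ℝ p (x - z)
      + 1 / lam * inner ℝ (grad₁ d x c) (z - x))
      = -(lam * ε * f z x) + lam * inner ℝ p (x - z) + inner ℝ (grad₁ d x c) (z - x) := by
    field_simp
  linarith

theorem IsIteration.asymptotics (hD : IsInducedProximalDistance S d D) (hKS : K ⊆ interior S)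
    (hf : IsMonotoneBifunction K f) (hh : IsMonotoneBifunction K h) {ε lam : ℕ → ℝ}
    (hε : ∀ k, 0 < ε k) (hlam : ∀ k, 0 < lam k) {x : ℕ → Rn n}
    (hx : IsIteration K f h d ε lam x) {z p : Rn n} (hz : z ∈ equilibriumSet f K)
    (hp : p ∈ normalCone (equilibriumSet f K) z) (hpz : -p ∈ subdifferentialOn K (h z) z)
    (hH : ConditionH K f ε lam z p) :
    (∃ l : ℝ≥0, Tendsto (fun k => D z (x k)) atTop (𝓝 (l : ℝ≥0∞))) ∧
    Bornology.IsBounded (range x) ∧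
    (Tendsto (fun k => D (x (k + 1)) (x k)) atTop (𝓝 0) ∧
      Tendsto (fun k => x (k + 1) - x k) atTop (𝓝 0)) ∧
    ((∀ k, 0 ≤ lam k * ε k * f z (x (k + 1))) ∧
      Summable (fun k => lam k * ε k * f z (x (k + 1)))) := by
  have hxK := hx.mem
  have hxS : ∀ k, x k ∈ interior S := fun k => hKS (hxK k)
  have hzS : z ∈ interior S := hKS hz.1
  have hfin : ∀ k, D z (x k) ≠ ⊤ := fun k => hD.finite z hzS _ (hxS k)
  have hfin' : ∀ k, D (x (k + 1)) (x k) ≠ ⊤ := fun k => hD.finite _ (hxS _) _ (hxS k)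
  have hnonneg : ∀ k, 0 ≤ lam k * ε k * f z (x (k + 1)) := fun k =>
    mul_nonneg (mul_pos (hlam k) (hε k)).le (hz.2 _ (hxK _))
  obtain ⟨γ, hγ, hγle⟩ := hD.exists_toReal_le
  obtain ⟨e, he, hes, hele⟩ := hH.exists_summable hε hlam hp (y := fun k => x (k + 2))
    fun k => hxK _
  -- The series in condition (H) starts at `k = 1`, so the quasi-Fejér property does too.
  obtain ⟨⟨l, hl⟩, hsum⟩ := exists_tendsto_and_summable_of_add_le
    (a := fun k => (D z (x (k + 1))).toReal)
    (b := fun k => γ * (D (x (k + 2)) (x (k + 1))).toReal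
      + lam (k + 1) * ε (k + 1) * f z (x (k + 2)) / 2) (e := e)
    (fun k => ENNReal.toReal_nonneg)
    (fun k => add_nonneg (mul_nonneg hγ.le ENNReal.toReal_nonneg)
      (div_nonneg (hnonneg (k + 1)) zero_le_two)) he hes
    (fun k => by
      have h1 := inner_grad₁_ge_of_mem_equilibriumSet_regularized hf hh (hε (k + 1))
        (hlam (k + 1)) (hx.2 (k + 1)) hpz
      have h2 := hγle (x (k + 2)) (hxS _) (x (k + 1)) (hxS _) z hzS
      have h3 := hele k
      simp only [add_assoc, one_add_one_eq_two] at h1 h2 h3 ⊢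
      linarith)
  have hl' : Tendsto (fun k => (D z (x k)).toReal) atTop (𝓝 l) :=
    (tendsto_add_atTop_iff_nat 1).1 hl
  have hbdd : Bornology.IsBounded (range x) := by
    obtain ⟨α, hα⟩ := hl'.bddAbove_range
    refine (hD.h3 z (interior_subset hzS) α).subset ?_
    rintro _ ⟨k, rfl⟩
    refine ⟨hxS k, ?_⟩
    rw [← EReal.coe_ennreal_toReal (hfin k)]
    exact_mod_cast hα (mem_range_self k)
  have hsumD : Summable fun k => (D (x (k + 2)) (x (k + 1))).toReal := by
    refine Summable.of_nonneg_of_le (fun k => ENNReal.toReal_nonneg) (fun k => ?_)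
      (hsum.mul_left γ⁻¹)
    rw [mul_add, inv_mul_cancel_left₀ hγ.ne']
    exact le_add_of_nonneg_right
      (mul_nonneg (inv_nonneg.2 hγ.le) (div_nonneg (hnonneg (k + 1)) zero_le_two))
  have hD0 : Tendsto (fun k => D (x (k + 1)) (x k)) atTop (𝓝 0) := by
    rw [← ENNReal.tendsto_toReal_iff hfin' ENNReal.zero_ne_top, ENNReal.toReal_zero]
    exact (tendsto_add_atTop_iff_nat 1).1 hsumD.tendsto_atTop_zero
  refine ⟨⟨l.toNNReal, ?_⟩, hbdd, ⟨hD0, ?_⟩, hnonneg, ?_⟩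
  · have := ENNReal.tendsto_ofReal hl'
    simp only [ENNReal.ofReal_toReal (hfin _)] at this
    exact this
  · exact hD.tendsto_sub_zero (fun k => hxS _) hxS
      (hbdd.subset (range_subset_iff.2 fun k => mem_range_self _)) hbdd hD0
  · refine (summable_nat_add_iff 1).1 (Summable.of_nonneg_of_le (fun k => hnonneg (k + 1))
      (fun k => ?_) (hsum.mul_left 2))
    have := mul_nonneg hγ.le (ENNReal.toReal_nonneg (a := D (x (k + 2)) (x (k + 1))))
    simp only [add_assoc, one_add_one_eq_two]
    linarith

/-- A sequence that becomes constant at a solution of the equilibrium problem for `f` has the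
asymptotics of the iterates trivially: monotonicity makes `f(z, ·)` vanish at that solution. -/
theorem asymptotics_of_eventually_const (hD : IsInducedProximalDistance S d D)
    (hKS : K ⊆ interior S) (hf : IsMonotoneBifunction K f) {ε lam : ℕ → ℝ}
    (hε : ∀ k, 0 < ε k) (hlam : ∀ k, 0 < lam k) {x : ℕ → Rn n} (hxK : ∀ k, x k ∈ K) {j : ℕ}
    (hj : x j ∈ equilibriumSet f K) (hconst : ∀ k, j ≤ k → x k = x j)
    {z : Rn n} (hz : z ∈ equilibriumSet f K) :
    (∃ l : ℝ≥0, Tendsto (fun k => D z (x k)) atTop (𝓝 (l : ℝ≥0∞))) ∧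
    Bornology.IsBounded (range x) ∧
    (Tendsto (fun k => D (x (k + 1)) (x k)) atTop (𝓝 0) ∧
      Tendsto (fun k => x (k + 1) - x k) atTop (𝓝 0)) ∧
    ((∀ k, 0 ≤ lam k * ε k * f z (x (k + 1))) ∧
      Summable (fun k => lam k * ε k * f z (x (k + 1)))) := by
  have hev : ∀ᶠ k in atTop, x k = x j := (eventually_ge_atTop j).mono hconst
  have hev' : ∀ᶠ k in atTop, x (k + 1) = x j :=
    (eventually_ge_atTop j).mono fun k hk => hconst _ (hk.trans k.le_succ)
  have hlim : Tendsto x atTop (𝓝 (x j)) := tendsto_const_nhds.congr' (hev.mono fun k hk => hk.symm)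
  have hfj : f z (x j) = 0 := le_antisymm
    (by linarith [hf.monotone z hz.1 _ hj.1, hj.2 z hz.1]) (hz.2 _ hj.1)
  refine ⟨⟨(D z (x j)).toNNReal, ?_⟩, Metric.isBounded_range_of_tendsto x hlim, ⟨?_, ?_⟩,
    fun k => mul_nonneg (mul_pos (hlam k) (hε k)).le (hz.2 _ (hxK _)), ?_⟩
  · rw [ENNReal.coe_toNNReal (hD.finite z (hKS hz.1) _ (hKS hj.1))]
    exact tendsto_const_nhds.congr' (hev.mono fun k hk => by simp only [hk])
  · refine tendsto_const_nhds.congr' ((hev.and hev').mono fun k hk => ?_)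
    simp only [hk.1, hk.2, hD.h2 _ (hKS hj.1)]
  · refine tendsto_const_nhds.congr' ((hev.and hev').mono fun k hk => ?_)
    simp only [hk.1, hk.2, sub_self]
  · refine summable_of_ne_finset_zero (s := Finset.range j) fun k hk => ?_
    rw [hconst (k + 1) ((not_lt.1 (mt Finset.mem_range.2 hk)).trans k.le_succ), hfj, mul_zero]

end

/-! ### The convergence theorem -/

theorem mainTheorem2 {n : ℕ} (S K : Set (Rn n)) (f h : Rn n → Rn n → ℝ)
    (d D : Rn n → Rn n → ℝ≥0∞) (ε lam : ℕ → ℝ) (θ : ℝ)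
    (hS_closed : IsClosed S) (hS_convex : Convex ℝ S) (hS_int : (interior S).Nonempty)
    (hK_closed : IsClosed K) (hK_convex : Convex ℝ K)
    (hd : IsProximalDistance S d) (hD : IsInducedProximalDistance S d D)
    (hK_dom : ∀ y ∈ interior S, K ⊆ interior {x | d x y ≠ ⊤})
    (hd_mono : ∀ c ∈ K, ∀ x ∈ K, ∀ y ∈ K, x ≠ y →
      (0 : ℝ) < inner ℝ (grad₁ d x c - grad₁ d y c) (x - y))
    (hf : IsMonotoneBifunction K f) (hh : IsMonotoneBifunction K h)
    (hε_pos : ∀ k, 0 < ε k) (hε : Tendsto ε atTop atTop)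
    (hθ : 0 < θ) (hlam : ∀ k, θ ≤ lam k)
    (hL6 : ∀ k, ∀ c ∈ K, CoercivityL6 K f h d (ε k) (lam k) c)
    (hS_ne : (equilibriumSet f K).Nonempty) :
    ∀ x₀ ∈ K,
      ((∃! x : ℕ → Rn n, x 0 = x₀ ∧ IsIteration K f h d ε lam x) ∧
        (∃! x : ℕ → Rn n, x 0 = x₀ ∧ IsStoppedIteration K f h d ε lam x)) ∧
      ∀ x : ℕ → Rn n, x 0 = x₀ →
        (IsIteration K f h d ε lam x ∨ IsStoppedIteration K f h d ε lam x) →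
        ∀ z ∈ equilibriumSet h (equilibriumSet f K),
        ∀ p ∈ normalCone (equilibriumSet f K) z, -p ∈ subdifferentialOn K (h z) z →
          ConditionH K f ε lam z p →
          (∃ l : ℝ≥0, Tendsto (fun k => D z (x k)) atTop (𝓝 (l : ℝ≥0∞))) ∧
          Bornology.IsBounded (range x) ∧
          (Tendsto (fun k => D (x (k + 1)) (x k)) atTop (𝓝 0) ∧
            Tendsto (fun k => x (k + 1) - x k) atTop (𝓝 0)) ∧
          ((∀ k, 0 ≤ lam k * ε k * f z (x (k + 1))) ∧
            Summable (fun k => lam k * ε k * f z (x (k + 1)))) := by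
  have hKS : K ⊆ interior S := hd.subset_interior hS_int hK_dom
  have hlam_pos : ∀ k, 0 < lam k := fun k => hθ.trans_le (hlam k)
  have hstep : ∀ k, ∀ c ∈ K,
      ∃! x, x ∈ equilibriumSet (regularized f h d (ε k) (lam k) c) K := fun k c hc =>
    existsUnique_mem_equilibriumSet_regularized hf hh hK_convex hK_closed (hε_pos k) (hlam_pos k)
      hc ((hd.continuousOn_grad₁ (hKS hc)).mono hKS) (hd_mono c hc) (hL6 k c hc)
  intro x₀ hx₀
  refine ⟨⟨existsUnique_isIteration hstep hx₀, existsUnique_isStoppedIteration hstep hx₀⟩, ?_⟩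
  rintro y hy0 hy z hz p hp hpz hH
  obtain ⟨x, ⟨hx0, hx⟩, hx_unique⟩ := existsUnique_isIteration hstep hx₀
  have hyx : y = x ∨ ∃ j, x j ∈ equilibriumSet f K ∧ y = fun k => x (min k j) := by
    rcases hy with hy | hy
    · exact Or.inl (hx_unique y ⟨hy0, hy⟩)
    · exact hy.eq_or_eq_min hstep hx (hy0.trans hx0.symm)
  rcases hyx with rfl | ⟨j, hj, rfl⟩
  · exact hx.asymptotics hD hKS hf hh hε_pos hlam_pos hz.1 hp hpz hH
  · exact asymptotics_of_eventually_const hD hKS hf hε_pos hlam_pos (fun k => hx.mem _)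
      (j := j) (by simpa using hj) (fun k hk => by simp [min_eq_right hk]) hz.1
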